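/- Let $N$ be a closed (i.e. compact, Hausdorff, without boundary), connected, orientable smooth $3$-manifold. Suppose that $N$ is stably parallelizable, i.e. the Whitney sum $TN\oplus\varepsilon$ of its tangent bundle with the trivial real line bundle $\varepsilon$ is (smoothly) isomorphic to the product bundle $N\times\mathbb{R}^4$. Then: (1) $N$ admits a quasi-framing: there are a smoothly embedded closed $3$-disk $B\subset N$ and a framing of $N_0=N\setminus\mathrm{Int}(B)$, i.e. a triple of smooth tangent vector fields along $N_0$ (smooth up to the boundary $\partial B$) which are linearly independent at every point of $N_0$; (2) consequently $N$ is parallelizable: there is a framing of $N$, i.e. a triple of smooth tangent vector fields on $N$ which are linearly independent at every point of $N$. -/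

import Mathlib

open scoped Manifold ContDiff Bundle

section BundleIso

variable {EB HB B : Type*} [NormedAddCommGroup EB] [NormedSpace ℝ EB] [TopologicalSpace HB]
  (I : ModelWithCorners ℝ EB HB) [TopologicalSpace B] [ChartedSpace HB B]
  (F₁ : Type*) [NormedAddCommGroup F₁] [NormedSpace ℝ F₁]
  (E₁ : B → Type*) [∀ x, AddCommGroup (E₁ x)] [∀ x, Module ℝ (E₁ x)]
  [∀ x, TopologicalSpace (E₁ x)] [TopologicalSpace (Bundle.TotalSpace F₁ E₁)]
  [FiberBundle F₁ E₁]
  (F₂ : Type*) [NormedAddCommGroup F₂] [NormedSpace ℝ F₂]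
  (E₂ : B → Type*) [∀ x, AddCommGroup (E₂ x)] [∀ x, Module ℝ (E₂ x)]
  [∀ x, TopologicalSpace (E₂ x)] [TopologicalSpace (Bundle.TotalSpace F₂ E₂)]
  [FiberBundle F₂ E₂]

/-- A smooth isomorphism, over the identity of the base, between two smooth real vector bundles
`E₁` and `E₂` (with model fibres `F₁` and `F₂`): a family of linear isomorphisms of the fibres
which, together with the family of inverses, is smooth as a map of total spaces. -/
structure SmoothVectorBundleIso where
  /-- the isomorphism on each fibre -/
  fiberEquiv : ∀ x : B, E₁ x ≃ₗ[ℝ] E₂ x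
  contMDiff_toFun : ContMDiff (I.prod 𝓘(ℝ, F₁)) (I.prod 𝓘(ℝ, F₂)) ∞
    (fun p : Bundle.TotalSpace F₁ E₁ =>
      (⟨p.1, fiberEquiv p.1 p.2⟩ : Bundle.TotalSpace F₂ E₂))
  contMDiff_invFun : ContMDiff (I.prod 𝓘(ℝ, F₂)) (I.prod 𝓘(ℝ, F₁)) ∞
    (fun p : Bundle.TotalSpace F₂ E₂ =>
      (⟨p.1, (fiberEquiv p.1).symm p.2⟩ : Bundle.TotalSpace F₁ E₁))

end BundleIso

section Disk

variable {E M : Type*} [NormedAddCommGroup E] [NormedSpace ℝ E] [TopologicalSpace M]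
  [ChartedSpace E M]

/-- `f` restricts to a smooth embedding into `M` of the closed unit ball of `E` (for `E = ℝ^n`, the
disk `D^n`): it is smooth on the closed ball (up to the boundary), injective there, and its
differential is injective at every point of the closed ball. Only the values of `f` on the closed
ball matter. -/
def IsEmbeddedDisk (f : E → M) : Prop :=
  ContMDiffOn 𝓘(ℝ, E) 𝓘(ℝ, E) ∞ f (Metric.closedBall 0 1) ∧
  Set.InjOn f (Metric.closedBall 0 1) ∧
  ∀ y ∈ Metric.closedBall (0 : E) 1,
    Function.Injective (mfderivWithin 𝓘(ℝ, E) 𝓘(ℝ, E) f (Metric.closedBall 0 1) y)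

end Disk

section Manifolds

variable (n : ℕ) (M : Type*) [TopologicalSpace M] [ChartedSpace (EuclideanSpace ℝ (Fin n)) M]

/-- A smooth manifold (without boundary) is orientable if it is covered by a family of smooth
charts all of whose transition maps have everywhere positive Jacobian determinant. -/
def IsOrientableManifold : Prop :=
  ∃ A ⊆ IsManifold.maximalAtlas (𝓡 n) ∞ M,
    (∀ x : M, ∃ e ∈ A, x ∈ e.source) ∧
    ∀ e ∈ A, ∀ e' ∈ A, ∀ y ∈ (e.symm.trans e').source,
      0 < (fderiv ℝ (e.symm.trans e') y).det

variable [IsManifold (𝓡 n) ∞ M]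

/-- `M` is stably parallelizable: the Whitney sum `TM ⊕ ε` of the tangent bundle with the trivial
line bundle is a product bundle, i.e. smoothly isomorphic to the trivial bundle `ε^(n+1)`. -/
def IsStablyParallelizable : Prop :=
  Nonempty (SmoothVectorBundleIso (𝓡 n)
    (EuclideanSpace ℝ (Fin n) × ℝ)
    (TangentSpace (𝓡 n) ×ᵇ Bundle.Trivial M ℝ)
    (EuclideanSpace ℝ (Fin (n + 1)))
    (Bundle.Trivial M (EuclideanSpace ℝ (Fin (n + 1)))))

variable {n M}

/-- `V` is a framing on the subset `S` of the `n`-manifold `M`: an `n`-tuple of smooth tangent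
vector fields along `S` which are linearly independent (in particular nonzero) at every point of
`S`. Only the values of `V` on `S` matter. When `S` is a codimension `0` submanifold with boundary,
`TS` is the restriction of `TM` to `S`, and this is a framing of `S`, smooth up to the boundary. -/
def IsFramingOn (V : Fin n → (x : M) → TangentSpace (𝓡 n) x) (S : Set M) : Prop :=
  (∀ i, ContMDiffOn (𝓡 n) (𝓡 n).tangent ∞
    (fun x => (⟨x, V i x⟩ : TangentBundle (𝓡 n) M)) S) ∧
  ∀ x ∈ S, LinearIndependent ℝ (fun i => V i x)

variable (n M)

/-- `M` is parallelizable: it admits a framing. -/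
def IsParallelizable : Prop :=
  ∃ V : Fin n → (x : M) → TangentSpace (𝓡 n) x, IsFramingOn V Set.univ

/-- `M` admits a quasi-framing: a framing of `M \ Int B`, where `B` is a smoothly embedded closed
`n`-disk in `M` (the image of the closed unit ball; `Int B` is the image of the open unit ball). -/
def AdmitsQuasiFraming : Prop :=
  ∃ f : EuclideanSpace ℝ (Fin n) → M, IsEmbeddedDisk f ∧
    ∃ V : Fin n → (x : M) → TangentSpace (𝓡 n) x,
      IsFramingOn V (f '' Metric.ball 0 1)ᶜ

end Manifolds

/-!
A trivialization `Φ : TN ⊕ ε ≅ N × ℝ⁴` sends the constant section `1` of `ε` to a nowhere zero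
smooth function `s : N → ℝ⁴`, and `TN` is isomorphic to the quotient of the trivial bundle by the
line spanned by `s`; in other words, `TN` is the pullback of `TS³` under `s / |s| : N → S³`. But
`S³` is parallelizable: identifying `ℝ⁴` with the quaternions, `q i, q j, q k` frame the tangent
space of the sphere through `q`. So the tangential parts of `Φ⁻¹ (s i), Φ⁻¹ (s j), Φ⁻¹ (s k)` frame
`TN`. They are independent because a relation between them says that `s * r = 0` for a
quaternion `r` whose imaginary coordinates are the coefficients of the relation
(`eq_zero_of_sum_mul_imaginaryUnit_eq`), and the quaternions have no zero divisors.

A quasi-framing is then obtained by restricting this framing to the complement of any embedded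
disk, and a small closed ball in a chart is such a disk (`exists_isEmbeddedDisk`).
-/

/-! ### Sections of Whitney sums and of trivial bundles -/

section Sections

variable {EB HB B : Type*} [NormedAddCommGroup EB] [NormedSpace ℝ EB] [TopologicalSpace HB]
  {I : ModelWithCorners ℝ EB HB} [TopologicalSpace B] [ChartedSpace HB B] {k : ℕ∞ω}
  {F₁ : Type*} [NormedAddCommGroup F₁] [NormedSpace ℝ F₁]
  {E₁ : B → Type*} [∀ x, AddCommGroup (E₁ x)]
  [∀ x, TopologicalSpace (E₁ x)] [TopologicalSpace (Bundle.TotalSpace F₁ E₁)]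
  [FiberBundle F₁ E₁]
  {F₂ : Type*} [NormedAddCommGroup F₂] [NormedSpace ℝ F₂]
  {E₂ : B → Type*} [∀ x, AddCommGroup (E₂ x)]
  [∀ x, TopologicalSpace (E₂ x)] [TopologicalSpace (Bundle.TotalSpace F₂ E₂)]
  [FiberBundle F₂ E₂]

theorem contMDiff_section_whitneySum_iff {s : ∀ x, E₁ x} {t : ∀ x, E₂ x} :
    ContMDiff I (I.prod 𝓘(ℝ, F₁ × F₂)) k
        (fun x => (⟨x, (s x, t x)⟩ : Bundle.TotalSpace (F₁ × F₂) (E₁ ×ᵇ E₂))) ↔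
      ContMDiff I (I.prod 𝓘(ℝ, F₁)) k (fun x => (⟨x, s x⟩ : Bundle.TotalSpace F₁ E₁)) ∧
      ContMDiff I (I.prod 𝓘(ℝ, F₂)) k (fun x => (⟨x, t x⟩ : Bundle.TotalSpace F₂ E₂)) := by
  simp only [ContMDiff, ← forall_and]
  refine forall_congr' fun x => ?_
  rw [Bundle.contMDiffAt_section (E := E₁), Bundle.contMDiffAt_section (E := E₂),
    Bundle.contMDiffAt_section (E := E₁ ×ᵇ E₂)]
  exact contMDiffAt_prod_module_iff _

theorem contMDiff_section_trivial_iff {f : B → F₁} :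
    ContMDiff I (I.prod 𝓘(ℝ, F₁)) k
        (fun x => (⟨x, f x⟩ : Bundle.TotalSpace F₁ (Bundle.Trivial B F₁))) ↔
      ContMDiff I 𝓘(ℝ, F₁) k f :=
  forall_congr' fun x => Bundle.contMDiffAt_section (E := Bundle.Trivial B F₁) x

end Sections

/-! ### Embedded disks -/

section Disk

variable {E M : Type*} [NormedAddCommGroup E] [NormedSpace ℝ E] [TopologicalSpace M]
  [ChartedSpace E M] [IsManifold 𝓘(ℝ, E) ∞ M]

/-- Every point of a manifold without boundary lies in an embedded disk: rescale a small closed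
ball in a chart around the point. -/
theorem exists_isEmbeddedDisk (x : M) : ∃ f : E → M, f 0 = x ∧ IsEmbeddedDisk f := by
  set e := chartAt E x
  obtain ⟨r, hr, hball⟩ := Metric.nhds_basis_closedBall.mem_iff.1
    (e.open_target.mem_nhds (mem_chart_target E x))
  let a : E → E := fun y => e x + r • y
  have ha : ContDiff ℝ ∞ a := by fun_prop
  have hmaps : Set.MapsTo a (Metric.closedBall 0 1) e.target := fun y hy => hball <| by
    rw [mem_closedBall_zero_iff] at hy
    simpa [a, e, dist_eq_norm, norm_smul, abs_of_pos hr] using mul_le_of_le_one_right hr.le hy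
  have hinj : Function.Injective a := fun y z h => by simpa [a, hr.ne'] using h
  refine ⟨e.symm ∘ a, by simp [a, e], ?_, ?_, fun y hy => ?_⟩
  · exact contMDiffOn_chart_symm.comp ha.contMDiff.contMDiffOn hmaps
  · exact e.symm.injOn.comp hinj.injOn hmaps
  · have huniq : UniqueMDiffWithinAt 𝓘(ℝ, E) (Metric.closedBall (0 : E) 1) y :=
      (uniqueDiffOn_convex (convex_closedBall 0 1)
        ⟨0, by simp [interior_closedBall (0 : E) one_ne_zero]⟩ y hy).uniqueMDiffWithinAt
    have he := (mdifferentiable_chart (I := 𝓘(ℝ, E)) x).symm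
    have hda : HasFDerivAt a (r • ContinuousLinearMap.id ℝ E) y :=
      ((hasFDerivAt_id y).const_smul r).const_add _
    have hd : MDifferentiableAt 𝓘(ℝ, E) 𝓘(ℝ, E) (e.symm ∘ a) y :=
      (he.mdifferentiableAt (hmaps hy)).comp y hda.differentiableAt.mdifferentiableAt
    rw [mfderivWithin_eq_mfderiv huniq hd, mfderiv_comp y (he.mdifferentiableAt (hmaps hy))
      hda.differentiableAt.mdifferentiableAt, mfderiv_eq_fderiv, hda.fderiv]
    refine (he.mfderiv_injective (hmaps hy)).comp fun v w h => ?_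
    exact smul_right_injective E hr.ne' h

end Disk

/-! ### The quaternionic framing of the three-sphere -/

section Quaternion

open Quaternion

/-- The imaginary units `i, j, k` of the quaternions. -/
def imaginaryUnit : Fin 3 → ℍ[ℝ] := ![⟨0, 1, 0, 0⟩, ⟨0, 0, 1, 0⟩, ⟨0, 0, 0, 1⟩]

/-- The vectors `q i, q j, q k` are linearly independent modulo the line spanned by `q ≠ 0`. -/
theorem eq_zero_of_sum_mul_imaginaryUnit_eq {q : ℍ[ℝ]} (hq : q ≠ 0) {c : Fin 3 → ℝ} {t : ℝ}
    (h : ∑ i, c i • (q * imaginaryUnit i) = t • q) (i : Fin 3) : c i = 0 := by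
  have hmul : q * (∑ i, c i • imaginaryUnit i - t • 1) = 0 := by
    simp [mul_sub, Finset.mul_sum, h]
  have hzero := (mul_eq_zero.1 hmul).resolve_left hq
  rw [Fin.sum_univ_three] at hzero
  fin_cases i
  · have him := congrArg QuaternionAlgebra.imI hzero
    simp only [imI_sub, imI_add, imI_smul] at him
    simpa [imaginaryUnit] using him
  · have him := congrArg QuaternionAlgebra.imJ hzero
    simp only [imJ_sub, imJ_add, imJ_smul] at him
    simpa [imaginaryUnit] using him
  · have him := congrArg QuaternionAlgebra.imK hzero
    simp only [imK_sub, imK_add, imK_smul] at him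
    simpa [imaginaryUnit] using him

/-- Right multiplication by the `i`-th imaginary unit, as a map of `ℝ⁴`. -/
noncomputable def mulImaginaryUnit (i : Fin 3) :
    EuclideanSpace ℝ (Fin 4) →L[ℝ] EuclideanSpace ℝ (Fin 4) :=
  linearIsometryEquivTuple.toContinuousLinearEquiv.toContinuousLinearMap ∘L
    (ContinuousLinearMap.mul ℝ ℍ[ℝ]).flip (imaginaryUnit i) ∘L
      linearIsometryEquivTuple.symm.toContinuousLinearEquiv.toContinuousLinearMap

theorem eq_zero_of_sum_mulImaginaryUnit_eq {v : EuclideanSpace ℝ (Fin 4)} (hv : v ≠ 0)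
    {c : Fin 3 → ℝ} {t : ℝ} (h : ∑ i, c i • mulImaginaryUnit i v = t • v) (i : Fin 3) :
    c i = 0 := by
  refine eq_zero_of_sum_mul_imaginaryUnit_eq (q := linearIsometryEquivTuple.symm v) (t := t)
    ((map_ne_zero_iff _ linearIsometryEquivTuple.symm.injective).2 hv) ?_ i
  apply linearIsometryEquivTuple.injective
  rw [map_sum, map_smul, LinearIsometryEquiv.apply_symm_apply, ← h]
  exact Finset.sum_congr rfl fun j _ => map_smul _ _ _

end Quaternion

/-! ### Stably parallelizable three-manifolds -/

theorem IsStablyParallelizable.isParallelizable {N : Type*} [TopologicalSpace N]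
    [ChartedSpace (EuclideanSpace ℝ (Fin 3)) N] [IsManifold (𝓡 3) ∞ N]
    (hst : IsStablyParallelizable 3 N) : IsParallelizable 3 N := by
  obtain ⟨Φ⟩ := hst
  -- `s` is the image of the unit section of the trivial line bundle.
  let s : N → EuclideanSpace ℝ (Fin 4) := fun x =>
    Φ.fiberEquiv x ((0 : TangentSpace (𝓡 3) x), (1 : ℝ))
  have hs : ContMDiff (𝓡 3) 𝓘(ℝ, EuclideanSpace ℝ (Fin 4)) ∞ s :=
    contMDiff_section_trivial_iff.1 <| Φ.contMDiff_toFun.comp <|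
      contMDiff_section_whitneySum_iff.2
        ⟨Bundle.contMDiff_zeroSection ℝ (TangentSpace (𝓡 3) : N → Type _),
          contMDiff_section_trivial_iff.2 contMDiff_const⟩
  let W (i : Fin 3) (x : N) : TangentSpace (𝓡 3) x × ℝ :=
    (Φ.fiberEquiv x).symm (mulImaginaryUnit i (s x))
  refine ⟨fun i x => (W i x).1, fun i => ?_, fun x _ => ?_⟩
  · have hW : ContMDiff (𝓡 3) ((𝓡 3).prod 𝓘(ℝ, EuclideanSpace ℝ (Fin 3) × ℝ)) ∞
        (fun x => (⟨x, ((W i x).1, (W i x).2)⟩ : Bundle.TotalSpace (EuclideanSpace ℝ (Fin 3) × ℝ)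
          (TangentSpace (𝓡 3) ×ᵇ Bundle.Trivial N ℝ))) :=
      Φ.contMDiff_invFun.comp <| contMDiff_section_trivial_iff.2 <|
        (mulImaginaryUnit i).contMDiff.comp hs
    exact (contMDiff_section_whitneySum_iff.1 hW).1.contMDiffOn
  · have hsx : s x ≠ 0 := fun h => one_ne_zero (α := ℝ) <|
      congrArg Prod.snd ((Φ.fiberEquiv x).map_eq_zero_iff.1 h)
    rw [Fintype.linearIndependent_iff]
    intro c hc
    refine eq_zero_of_sum_mulImaginaryUnit_eq hsx (t := ∑ i, c i * (W i x).2) ?_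
    -- The combination `∑ cᵢ Wᵢ` has vanishing tangential part, so it is a multiple of `Φ⁻¹ s`.
    have hsum : ∑ i, c i • W i x =
        (∑ i, c i * (W i x).2) • ((0 : TangentSpace (𝓡 3) x), (1 : ℝ)) := by
      refine Prod.ext ?_ ?_
      · simpa [Prod.fst_sum] using hc
      · simp [Prod.snd_sum]
    have himage := congrArg (Φ.fiberEquiv x) hsum
    rw [map_sum, map_smul] at himage
    simpa only [W, map_smul, LinearEquiv.apply_symm_apply] using himage

theorem lemma5p3 (N : Type*) [TopologicalSpace N] [T2Space N] [CompactSpace N] [ConnectedSpace N]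
    [ChartedSpace (EuclideanSpace ℝ (Fin 3)) N] [IsManifold (𝓡 3) ∞ N]
    (hor : IsOrientableManifold 3 N) (hst : IsStablyParallelizable 3 N) :
    AdmitsQuasiFraming 3 N ∧ IsParallelizable 3 N := by
  obtain ⟨V, hV⟩ := hst.isParallelizable
  obtain ⟨x⟩ : Nonempty N := inferInstance
  obtain ⟨f, -, hf⟩ := exists_isEmbeddedDisk (E := EuclideanSpace ℝ (Fin 3)) x
  exact ⟨⟨f, hf, V, fun i => (hV.1 i).mono (Set.subset_univ _), fun y _ => hV.2 y trivial⟩, V, hV⟩
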